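/- Let $L=\langle 0,1,+,\cdot,\le\rangle$ be the language of arithmetic, and let $L^e=\langle 0,1,+,\cdot,e,\le\rangle$, where $e$ is a partial binary function (given by its graph, a ternary relation). "Provable" means: a logical consequence, i.e. true in all models (by Gödel's completeness theorem this is the same as formal provability). Let $\mathrm{I}\Sigma_1$ be Robinson arithmetic together with induction for all $\Sigma_1$-formulas. Let $T$ be an $L$-theory that proves all axioms of $\mathrm{I}\Sigma_1$. Assume that for some $K\in\mathbb N$ and some rational $\varepsilon>0$, $T$ proves the $ABC$ inequality: for all positive $a,b,c$ with no common divisor other than $1$ and with $a+b=c$, $$c<K\,\mathrm{rad}(abc)^{1+\varepsilon},$$ where $\mathrm{rad}(x)$ is the product of all primes dividing $x$, taken without multiplicities (for $\varepsilon=p/q$ the inequality means $c^q<K^q\,\mathrm{rad}(abc)^{q+p}$). Assume also that $T$ proves Fermat's Last Theorem for the exponential $x^y$ that is definable in $\mathrm{I}\Sigma_1$: $a^n+b^n\ne c^n$ for all nonzero $a,b,c$ and all $n>2$. Consider the following axioms on $e$ in an $L^e$-structure with universe $B$: - (e0) $e$ is a function $B\times A\to B$ for some $L$-substructure $A$ of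 $B$ that satisfies Presburger arithmetic: $0\ne z+1$; $x\neq 0\to\exists z\,(x=z+1)$; $x+z=y+z\to x=y$; $x+0=x$; $x+(y+z)=(x+y)+z$; $x+y=y+x$; $x\le y\leftrightarrow\exists z\,(x+z=y)$; and $\exists y\,(ky\le x<k(y+1))$ for every standard $k>0$; - (e1) $(x=1\vee y=0)\leftrightarrow e(x,y)=1$; - (e2) $x\ne0\to e(x,y)\neq0$; - (e3) $e(x,1)=x$; - (e4) $e(x,y+z)=e(x,y)\cdot e(x,z)$; - (e5') $e(xy,z)=e(x,z)\cdot e(y,z)$; - (e8) if $x$ and $y$ are coprime, then so are $e(x,a)$ and $e(y,b)$; where the second arguments of $e$ range over $A$ and all other variables over $B$. Let $\mathrm{Exp}'$ be the set of axioms (e0)–(e4). Then Fermat's Last Theorem for $e$ is provable in $T+\mathrm{Exp}'+(\mathrm{e5}')+(\mathrm{e8})$: the equation $e(a,n)+e(b,n)=e(c,n)$ has no solution with $a,b,c\in B$ nonzero and $n\in A$, $n>2$. -/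

import Mathlib

namespace WeakExp

open FirstOrder FirstOrder.Language

/-! ### The language of arithmetic `⟨0, 1, +, ·, ≤⟩` -/

inductive ArithFunc : ℕ → Type
  | zero : ArithFunc 0
  | one : ArithFunc 0
  | add : ArithFunc 2
  | mul : ArithFunc 2

inductive ArithRel : ℕ → Type
  | le : ArithRel 2

/-- The language of arithmetic `⟨0, 1, +, ·, ≤⟩`. -/
abbrev arith : FirstOrder.Language.{0, 0} := ⟨ArithFunc, ArithRel⟩

instance : arith.IsOrdered := ⟨ArithRel.le⟩

instance {α : Type} : Zero (arith.Term α) := ⟨Constants.term (L := arith) ArithFunc.zero⟩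

instance {α : Type} : One (arith.Term α) := ⟨Constants.term (L := arith) ArithFunc.one⟩

instance {α : Type} : Add (arith.Term α) := ⟨Functions.apply₂ (L := arith) ArithFunc.add⟩

instance {α : Type} : Mul (arith.Term α) := ⟨Functions.apply₂ (L := arith) ArithFunc.mul⟩

/-- The numeral of a standard natural number: `((0 + 1) + 1) + ⋯ + 1`. -/
def num {α : Type} : ℕ → arith.Term α
  | 0 => 0
  | k + 1 => num (α := α) k + 1

/-- The power of a term with a standard exponent, as an iterated product. -/
def tpow {α : Type} (t : arith.Term α) : ℕ → arith.Term α
  | 0 => 1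
  | k + 1 => tpow t k * t

/-- The multiple of a term by a standard number, as an iterated sum. -/
def tmul {α : Type} : ℕ → arith.Term α → arith.Term α
  | 0, _ => 0
  | k + 1, t => tmul k t + t

/-- A term regarded as a term in the scope of one more quantifier. -/
def up {L : FirstOrder.Language.{0, 0}} {α : Type} {n : ℕ} (t : L.Term (α ⊕ Fin n)) :
    L.Term (α ⊕ Fin (n + 1)) :=
  t.relabel (Sum.map id Fin.castSucc)

/-- The variable bound by the innermost of `n + 1` quantifiers. -/
def new {L : FirstOrder.Language.{0, 0}} {α : Type} (n : ℕ) : L.Term (α ⊕ Fin (n + 1)) :=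
  &(Fin.last n)

/-! ### The theory `IΣ₁` -/

/-- `Δ₀`-formulas: all quantifiers are bounded, `∀ x ≤ t` or `∃ x ≤ t`, with `x` not in `t`. -/
inductive IsDelta0 {α : Type} : ∀ {n : ℕ}, arith.BoundedFormula α n → Prop
  | of_isQF {n : ℕ} {φ : arith.BoundedFormula α n} (h : φ.IsQF) : IsDelta0 φ
  | imp {n : ℕ} {φ ψ : arith.BoundedFormula α n} (hφ : IsDelta0 φ) (hψ : IsDelta0 ψ) :
      IsDelta0 (φ ⟹ ψ)
  | ball {n : ℕ} (t : arith.Term (α ⊕ Fin n)) {φ : arith.BoundedFormula α (n + 1)}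
      (hφ : IsDelta0 φ) : IsDelta0 (∀' (((new n).le (up t)) ⟹ φ))
  | bex {n : ℕ} (t : arith.Term (α ⊕ Fin n)) {φ : arith.BoundedFormula α (n + 1)}
      (hφ : IsDelta0 φ) : IsDelta0 (∃' (((new n).le (up t)) ⊓ φ))

/-- `Σ₁`-formulas: a block of existential quantifiers in front of a `Δ₀`-formula. -/
inductive IsSigma1 {α : Type} : ∀ {n : ℕ}, arith.BoundedFormula α n → Prop
  | of_isDelta0 {n : ℕ} {φ : arith.BoundedFormula α n} (h : IsDelta0 φ) : IsSigma1 φ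
  | ex {n : ℕ} {φ : arith.BoundedFormula α (n + 1)} (h : IsSigma1 φ) : IsSigma1 (∃' φ)

/-- The bound variable `i` of a formula with `n` bound variables and no free ones; the variables
of nested quantifiers are numbered from the outside, beginning with `X 0`. -/
def X {n : ℕ} (i : Fin n) : arith.Term (Empty ⊕ Fin n) := &i

/-- Robinson arithmetic, with `x + 1` as the successor of `x`. -/
def robinson : arith.Theory :=
  { ∀' ∼((X (n := 1) 0 + 1) =' 0),
    ∀' ∀' (((X (n := 2) 0 + 1) =' (X 1 + 1)) ⟹ (X 0 =' X 1)),
    ∀' (∼(X (n := 1) 0 =' 0) ⟹ ∃' (X (n := 2) 0 =' (X 1 + 1))),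
    ∀' ((X (n := 1) 0 + 0) =' X 0),
    ∀' ∀' ((X (n := 2) 0 + (X 1 + 1)) =' ((X 0 + X 1) + 1)),
    ∀' ((X (n := 1) 0 * 0) =' 0),
    ∀' ∀' ((X (n := 2) 0 * (X 1 + 1)) =' (X 0 * X 1 + X 0)),
    ∀' ∀' (((X (n := 2) 0).le (X 1)) ⇔ ∃' ((X (n := 3) 2 + X 0) =' X 1)) }

/-- The induction axiom for a formula `φ` with parameters `Sum.inl i` and induction variable
`x = Sum.inr 0`: the universal closure of `φ(0) ∧ ∀ x (φ(x) → φ(x + 1)) → ∀ x φ(x)`. -/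
noncomputable def induction {k : ℕ} (φ : arith.Formula (Fin k ⊕ Fin 1)) : arith.Sentence :=
  let base : arith.Formula (Fin k) :=
    BoundedFormula.subst φ (Sum.elim (fun i => Term.var i) (fun _ => 0))
  let succ : arith.Formula (Fin k ⊕ Fin 1) :=
    BoundedFormula.subst φ
      (Sum.elim (fun i => Term.var (Sum.inl i)) (fun j => Term.var (Sum.inr j) + 1))
  let ind : arith.Formula (Fin k) :=
    (base ⊓ Formula.iAlls (Fin 1) (φ.imp succ)) ⟹ Formula.iAlls (Fin 1) φ
  Formula.iAlls (Fin k) (Formula.relabel Sum.inr ind : arith.Formula (Empty ⊕ Fin k))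

/-- `IΣ₁`: Robinson arithmetic with induction for all `Σ₁`-formulas (with parameters). -/
def ISigma1 : arith.Theory :=
  robinson ∪ {σ | ∃ (k : ℕ) (φ : arith.Formula (Fin k ⊕ Fin 1)), IsSigma1 φ ∧ σ = induction φ}

/-! ### Arithmetical formulas -/

section formulas

variable {α : Type} {n : ℕ}

/-- `s ∣ t` -/
def dvd (s t : arith.Term (α ⊕ Fin n)) : arith.BoundedFormula α n :=
  ∃' (up t =' (up s * new n))

/-- `s` and `t` are coprime: their only common divisor is `1`. -/
def coprime (s t : arith.Term (α ⊕ Fin n)) : arith.BoundedFormula α n :=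
  ∀' (dvd (new n) (up s) ⟹ dvd (new n) (up t) ⟹ (new n =' 1))

/-- `s`, `t` and `u` are coprime: the only common divisor of the three is `1`. -/
def coprime₃ (s t u : arith.Term (α ⊕ Fin n)) : arith.BoundedFormula α n :=
  ∀' (dvd (new n) (up s) ⟹ dvd (new n) (up t) ⟹ dvd (new n) (up u) ⟹ (new n =' 1))

/-- `p` is a prime number. -/
def prime (p : arith.Term (α ⊕ Fin n)) : arith.BoundedFormula α n :=
  (Term.lt 1 p) ⊓ ∀' (dvd (new n) (up p) ⟹ ((new n =' 1) ⊔ (new n =' up p)))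

/-- `r = rad(a)`: `r` is the product, without multiplicities, of all primes dividing `a`,
i.e. `r` is squarefree and has the same prime divisors as `a`. -/
def isRad (a r : arith.Term (α ⊕ Fin n)) : arith.BoundedFormula α n :=
  (∀' (dvd (new n * new n) (up r) ⟹ (new n =' 1))) ⊓
    ∀' (prime (new n) ⟹ (dvd (new n) (up a) ⇔ dvd (new n) (up r)))

/-- `u` is the remainder of `c` modulo `m`. -/
def isRem (c m u : arith.Term (α ⊕ Fin n)) : arith.BoundedFormula α n :=
  (∃' (up c =' (up m * new n + up u))) ⊓ Term.lt u m

/-- Gödel's `β`-function: `u` is the `i`-th entry of the sequence coded by `c`, `d`. -/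
def beta (c d i u : arith.Term (α ⊕ Fin n)) : arith.BoundedFormula α n :=
  isRem c (1 + (i + 1) * d) u

/-- The graph `z = x ^ y` of the definable exponential: some coded sequence starts with `1`, each
of its next `y` entries is `x` times the preceding one, and its `y`-th entry is `z`. -/
def expGraph (x y z : arith.Term (α ⊕ Fin n)) : arith.BoundedFormula α n :=
  let c : arith.Term (α ⊕ Fin (n + 2)) := up (new n)
  let d : arith.Term (α ⊕ Fin (n + 2)) := new (n + 1)
  let i : arith.Term (α ⊕ Fin (n + 3)) := new (n + 2)
  let u : arith.Term (α ⊕ Fin (n + 4)) := new (n + 3)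
  ∃' ∃' (beta c d 0 1 ⊓
    (∀' (Term.lt i (up (up (up y))) ⟹
      ∃' (beta (up (up c)) (up (up d)) (up i) u ⊓
        beta (up (up c)) (up (up d)) (up i + 1) (u * up (up (up (up x))))))) ⊓
    beta c d (up (up y)) (up (up z)))

end formulas

/-- The `ABC` inequality with constants `K` and `ε = p / q`, for positive coprime `a`, `b`, `c` with
`a + b = c`: the inequality `c < K * rad(abc) ^ (1 + ε)`, raised to the `q`-th power, is
`c ^ q < K ^ q * rad(abc) ^ (q + p)`. -/
def abc (K : ℕ) (ε : ℚ) : arith.Sentence :=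
  let a := X (n := 4) 0
  let b := X (n := 4) 1
  let c := X (n := 4) 2
  let r := X (n := 4) 3
  ∀' ∀' ∀' ∀' (∼(a =' 0) ⟹ ∼(b =' 0) ⟹ ∼(c =' 0) ⟹ coprime₃ a b c ⟹ ((a + b) =' c) ⟹
    isRad (a * b * c) r ⟹
    Term.lt (tpow c ε.den) (tpow (num K) ε.den * tpow r (ε.den + ε.num.toNat)))

/-- Fermat's Last Theorem for the definable exponential. -/
def flt : arith.Sentence :=
  let a := X (n := 6) 0
  let b := X (n := 6) 1
  let c := X (n := 6) 2
  let k := X (n := 6) 3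
  let u := X (n := 6) 4
  let v := X (n := 6) 5
  ∀' ∀' ∀' ∀' ∀' ∀' (∼(a =' 0) ⟹ ∼(b =' 0) ⟹ ∼(c =' 0) ⟹ Term.lt (num 2) k ⟹
    expGraph a k u ⟹ expGraph b k v ⟹ ∼(expGraph c k (u + v)))

/-! ### The language with a partial exponential `e` -/

inductive ExpRel : ℕ → Type
  | graph : ExpRel 3

/-- The language `⟨0, 1, +, ·, e, ≤⟩`. As `e` is a partial function, it is given by its graph, a
ternary relation `e(x, y) = z`. -/
abbrev arithExp : FirstOrder.Language.{0, 0} := arith.sum ⟨fun _ => Empty, ExpRel⟩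

/-- The relation symbol for the graph of `e`. -/
def eRel : arithExp.Relations 3 := Sum.inr ExpRel.graph

/-- The inclusion of the language of arithmetic. -/
def incl : arith →ᴸ arithExp := LHom.sumInl

section formulas

variable {α : Type} {n : ℕ}

/-- An arithmetical formula as a formula of the larger language. -/
def ar (φ : arith.BoundedFormula α n) : arithExp.BoundedFormula α n :=
  incl.onBoundedFormula φ

/-- `e(s, t)` is defined and `e(s, t) = u`. -/
def E (s t u : arith.Term (α ⊕ Fin n)) : arithExp.BoundedFormula α n :=
  eRel.boundedFormula ![incl.onTerm s, incl.onTerm t, incl.onTerm u]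

/-- `t ∈ A`, where `A` is the set of exponents: `e(x, t)` is defined for some `x`. -/
def inA (t : arith.Term (α ⊕ Fin n)) : arithExp.BoundedFormula α n :=
  ∃' ∃' E (up (new n)) (up (up t)) (new (n + 1))

/-- The relativization of an arithmetical formula to `A`: it expresses that the formula holds
in the substructure `A`. -/
def relativize : ∀ {n : ℕ}, arith.BoundedFormula α n → arithExp.BoundedFormula α n
  | _, .falsum => .falsum
  | _, .equal s t => ar (.equal s t)
  | _, .rel R ts => ar (.rel R ts)
  | _, .imp φ ψ => relativize φ ⟹ relativize ψ
  | n, .all φ => ∀' (inA (new n) ⟹ relativize φ)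

end formulas

/-- The axioms of Presburger arithmetic. -/
def Pr : arith.Theory :=
  { ∀' ∼(0 =' (X (n := 1) 0 + 1)),
    ∀' (∼(X (n := 1) 0 =' 0) ⟹ ∃' (X (n := 2) 0 =' (X 1 + 1))),
    ∀' ∀' ∀' (((X (n := 3) 0 + X 2) =' (X 1 + X 2)) ⟹ (X 0 =' X 1)),
    ∀' ((X (n := 1) 0 + 0) =' X 0),
    ∀' ∀' ∀' ((X (n := 3) 0 + (X 1 + X 2)) =' ((X 0 + X 1) + X 2)),
    ∀' ∀' ((X (n := 2) 0 + X 1) =' (X 1 + X 0)),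
    ∀' ∀' (((X (n := 2) 0).le (X 1)) ⇔ ∃' ((X (n := 3) 0 + X 2) =' X 1)) } ∪
  {σ | ∃ k : ℕ, 0 < k ∧
    σ = ∀' ∃' (((tmul k (X (n := 2) 1)).le (X 0)) ⊓ Term.lt (X 0) (tmul k (X 1 + 1)))}

/-- (e0): `e` is a function `B × A → B`, where `A` is a substructure of `B` and a model
of Presburger arithmetic. -/
def e0 : arithExp.Theory :=
  { -- `e` is single-valued
    ∀' ∀' ∀' ∀' (E (n := 4) (X 0) (X 1) (X 2) ⟹ E (X 0) (X 1) (X 3) ⟹ ar (X 2 =' X 3)),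
    -- `e` is defined on all of `B × A`
    ∀' ∀' (inA (n := 2) (X 1) ⟹ ∃' E (X 0) (X 1) (X 2)),
    -- `A` is a substructure
    inA (n := 0) 0,
    inA (n := 0) 1,
    ∀' ∀' (inA (n := 2) (X 0) ⟹ inA (X 1) ⟹ inA (X 0 + X 1)),
    ∀' ∀' (inA (n := 2) (X 0) ⟹ inA (X 1) ⟹ inA (X 0 * X 1)) } ∪
  relativize '' Pr

/-- (e1): `(x = 1 ∨ y = 0) ↔ e(x, y) = 1` for `y ∈ A`. -/
def e1 : arithExp.Sentence :=
  ∀' ∀' (inA (n := 2) (X 1) ⟹ (ar ((X 0 =' 1) ⊔ (X 1 =' 0)) ⇔ E (X 0) (X 1) 1))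

/-- (e2): `x ≠ 0 → e(x, y) ≠ 0` for `y ∈ A`. -/
def e2 : arithExp.Sentence :=
  ∀' ∀' (inA (n := 2) (X 1) ⟹ ar ∼(X 0 =' 0) ⟹ ∼(E (X 0) (X 1) 0))

/-- (e3): `e(x, 1) = x`. -/
def e3 : arithExp.Sentence :=
  ∀' E (n := 1) (X 0) 1 (X 0)

/-- (e4): `e(x, y + z) = e(x, y) * e(x, z)` for `y, z ∈ A`. -/
def e4 : arithExp.Sentence :=
  ∀' ∀' ∀' ∀' ∀' (E (n := 5) (X 0) (X 1) (X 3) ⟹ E (X 0) (X 2) (X 4) ⟹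
    E (X 0) (X 1 + X 2) (X 3 * X 4))

/-- (e5'): `e(x * y, z) = e(x, z) * e(y, z)` for `z ∈ A`. -/
def e5' : arithExp.Sentence :=
  ∀' ∀' ∀' ∀' ∀' (E (n := 5) (X 0) (X 2) (X 3) ⟹ E (X 1) (X 2) (X 4) ⟹
    E (X 0 * X 1) (X 2) (X 3 * X 4))

/-- (e8): if `x` and `y` are coprime, then so are `e(x, a)` and `e(y, b)`, for `a, b ∈ A`. -/
def e8 : arithExp.Sentence :=
  ∀' ∀' ∀' ∀' ∀' ∀' (ar (coprime (n := 6) (X 0) (X 1)) ⟹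
    E (X 0) (X 2) (X 4) ⟹ E (X 1) (X 3) (X 5) ⟹ ar (coprime (X 4) (X 5)))

/-- The theory `Exp'`, consisting of the axioms (e0)-(e4). -/
def ExpPrime : arithExp.Theory := e0 ∪ {e1, e2, e3, e4}

/-- Fermat's Last Theorem for `e`: `e(a, k) + e(b, k) = e(c, k)` has no solution with nonzero
`a`, `b`, `c` and `k > 2` (in the domain of `e`). -/
def fltE : arithExp.Sentence :=
  ∀' ∀' ∀' ∀' ∀' ∀' (ar ∼(X 0 =' 0) ⟹ ar ∼(X 1 =' 0) ⟹ ar ∼(X 2 =' 0) ⟹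
    ar (Term.lt (num 2) (X 3)) ⟹ E (n := 6) (X 0) (X 3) (X 4) ⟹ E (X 1) (X 3) (X 5) ⟹
    ∼(E (X 2) (X 3) (X 4 + X 5)))

end WeakExp

/-! Work in a model of all the axioms and suppose `e(a, n) = u`, `e(b, n) = v`, `e(c, n) = u + v`.

If `n` is standard, (e3) and (e4) give `e(x, n) = x ^ n`. Sequences of standard length have
`β`-codes, so the definable exponential is also `x ^ n` there (`realize_expGraph_of_pow`), and the
assumed Fermat theorem applies.

If `n` is nonstandard, its predecessors stay in the domain of exponents, so `x ^ N` divides `e(x,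
n)` for every standard `N` (`IsExp.pow_dvd`). With (e8) it follows that `e(x, n)` and `x` have the
same prime divisors (`IsExp.isPrime_dvd_iff`). A common factor of `a, b, c` can be cancelled by
(e5') and (e2). Then `u` and `v` are coprime and `u * v * (u + v)` has the same radical `r` as `a *
b * c`. Thus `r ≤ a * b * c`, while every standard power of `a * b * c` is at most `(u + v) ^ 3`:
the radical is too small for the `ABC` inequality (`abc_inequality_false`).

The rest is elementary number theory in `IΣ₁`: Euclid's lemma, prime divisors, radicals and greatest
common divisors, each obtained from a least element of a `Δ₀`-set (`exists_least`). -/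

namespace WeakExp

open FirstOrder FirstOrder.Language

/-! ### Evaluation of terms in a structure. -/

/-- The symbols of `arith` are interpreted by the given operations of `M`. -/
class Interprets (M : Type) [Zero M] [One M] [Add M] [Mul M] [LE M] [arith.Structure M] : Prop
    extends arith.OrderedStructure M where
  funMap_zero (v : Fin 0 → M) : Structure.funMap (L := arith) ArithFunc.zero v = 0
  funMap_one (v : Fin 0 → M) : Structure.funMap (L := arith) ArithFunc.one v = 1
  funMap_add (v : Fin 2 → M) : Structure.funMap (L := arith) ArithFunc.add v = v 0 + v 1
  funMap_mul (v : Fin 2 → M) : Structure.funMap (L := arith) ArithFunc.mul v = v 0 * v 1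

section realize

variable {M : Type} [Zero M] [One M] [Add M] [Mul M] [LE M] [arith.Structure M] [Interprets M]
variable {α : Type} {n : ℕ}

@[simp] theorem realize_zero (v : α → M) : (0 : arith.Term α).realize v = 0 :=
  Interprets.funMap_zero _

@[simp] theorem realize_one (v : α → M) : (1 : arith.Term α).realize v = 1 :=
  Interprets.funMap_one _

@[simp] theorem realize_add (s t : arith.Term α) (v : α → M) :
    (s + t).realize v = s.realize v + t.realize v :=
  (Term.realize_functions_apply₂ (L := arith) (f := ArithFunc.add)).trans
    (Interprets.funMap_add _)

@[simp] theorem realize_mul (s t : arith.Term α) (v : α → M) :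
    (s * t).realize v = s.realize v * t.realize v :=
  (Term.realize_functions_apply₂ (L := arith) (f := ArithFunc.mul)).trans
    (Interprets.funMap_mul _)

end realize

@[simp] theorem realize_X {M : Type} [arith.Structure M] {n : ℕ} (i : Fin n)
    (v : Empty ⊕ Fin n → M) : (X i).realize v = v (Sum.inr i) := rfl

section realize

variable {L : FirstOrder.Language.{0, 0}} {M : Type} [L.Structure M] {α : Type} {n : ℕ}

@[simp] theorem realize_new (v : α ⊕ Fin (n + 1) → M) :
    (new (L := L) n).realize v = v (Sum.inr (Fin.last n)) := rfl

@[simp] theorem realize_up (t : L.Term (α ⊕ Fin n)) (v : α → M) (xs : Fin n → M) (a : M) :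
    (up t).realize (Sum.elim v (Fin.snoc xs a)) = t.realize (Sum.elim v xs) := by
  rw [up, Term.realize_relabel]
  congr 1
  ext i
  rcases i with i | i <;> simp

end realize

/-- The interpretation of the symbols in an arbitrary structure. -/
abbrev zeroOf (M : Type) [arith.Structure M] : Zero M :=
  ⟨Structure.funMap (L := arith) ArithFunc.zero ![]⟩

abbrev oneOf (M : Type) [arith.Structure M] : One M :=
  ⟨Structure.funMap (L := arith) ArithFunc.one ![]⟩

abbrev addOf (M : Type) [arith.Structure M] : Add M :=
  ⟨fun x y => Structure.funMap (L := arith) ArithFunc.add ![x, y]⟩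

abbrev mulOf (M : Type) [arith.Structure M] : Mul M :=
  ⟨fun x y => Structure.funMap (L := arith) ArithFunc.mul ![x, y]⟩

theorem interprets_of (M : Type) [arith.Structure M] :
    @Interprets M (zeroOf M) (oneOf M) (addOf M) (mulOf M) (arith.leOfStructure M) _ := by
  let := zeroOf M
  let := oneOf M
  let := addOf M
  let := mulOf M
  let := arith.leOfStructure M
  exact
    { relMap_leSymb := OrderedStructure.relMap_leSymb
      funMap_zero := fun v => congrArg _ (Subsingleton.elim _ _)
      funMap_one := fun v => congrArg _ (Subsingleton.elim _ _)
      funMap_add := fun v => congrArg _ (List.ofFn_inj.mp rfl)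
      funMap_mul := fun v => congrArg _ (List.ofFn_inj.mp rfl) }

/-! ### `Δ₀`-formulas and `Δ₀`-induction. -/

section delta0

variable {α : Type} {n : ℕ} {φ ψ : arith.BoundedFormula α n}

theorem IsDelta0.eq (s t : arith.Term (α ⊕ Fin n)) : IsDelta0 (s =' t) :=
  .of_isQF (BoundedFormula.IsAtomic.equal s t).isQF

theorem IsDelta0.le (s t : arith.Term (α ⊕ Fin n)) : IsDelta0 (s.le t) :=
  .of_isQF (BoundedFormula.IsAtomic.rel _ _).isQF

theorem IsDelta0.not (hφ : IsDelta0 φ) : IsDelta0 (∼φ) :=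
  hφ.imp (.of_isQF .falsum)

theorem IsDelta0.inf (hφ : IsDelta0 φ) (hψ : IsDelta0 ψ) : IsDelta0 (φ ⊓ ψ) :=
  (hφ.imp hψ.not).not

theorem IsDelta0.sup (hφ : IsDelta0 φ) (hψ : IsDelta0 ψ) : IsDelta0 (φ ⊔ ψ) :=
  hφ.not.imp hψ

/-- The induction variable, as a term. -/
def indVar {k : ℕ} : arith.Term ((Fin k ⊕ Fin 1) ⊕ Fin n) := Term.var (Sum.inl (Sum.inr 0))

/-- A parameter, as a term. -/
def param {k : ℕ} (i : Fin k) : arith.Term ((Fin k ⊕ Fin 1) ⊕ Fin n) :=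
  Term.var (Sum.inl (Sum.inl i))

@[simp] theorem realize_indVar {M : Type} [arith.Structure M] {k : ℕ} (p : Fin k → M)
    (f : Fin 1 → M) (xs : Fin n → M) :
    (indVar (n := n) (k := k)).realize (Sum.elim (Sum.elim p f) xs) = f 0 := rfl

@[simp] theorem realize_param {M : Type} [arith.Structure M] {k : ℕ} (i : Fin k) (p : Fin k → M)
    (f : Fin 1 → M) (xs : Fin n → M) :
    (param (n := n) i).realize (Sum.elim (Sum.elim p f) xs) = p i := rfl

end delta0

section induction

variable {M : Type} [Zero M] [One M] [Add M] [Mul M] [LE M] [arith.Structure M] [Interprets M]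

/-- `P` is the set of solutions of a `Δ₀`-formula with parameters. -/
def Delta0Set (P : M → Prop) : Prop :=
  ∃ (k : ℕ) (φ : arith.Formula (Fin k ⊕ Fin 1)) (p : Fin k → M), IsDelta0 φ ∧
    ∀ x, φ.Realize (Sum.elim p fun _ => x) ↔ P x

theorem induction_of_realize (hM : M ⊨ ISigma1) {k : ℕ} {φ : arith.Formula (Fin k ⊕ Fin 1)}
    (hφ : IsSigma1 φ) (p : Fin k → M) (h0 : φ.Realize (Sum.elim p fun _ => 0))
    (hs : ∀ x, φ.Realize (Sum.elim p fun _ => x) → φ.Realize (Sum.elim p fun _ => x + 1)) (x : M) :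
    φ.Realize (Sum.elim p fun _ => x) := by
  have h : M ⊨ induction φ := Theory.model_iff _ |>.1 hM _ (Or.inr ⟨k, φ, hφ, rfl⟩)
  simp only [induction, Sentence.Realize, Formula.realize_iAlls] at h
  have h := h p
  rw [Formula.realize_relabel, Formula.realize_imp, Formula.realize_inf, Formula.realize_iAlls,
    Formula.realize_iAlls] at h
  refine h ⟨?_, fun i => ?_⟩ fun _ => x
  · rw [Formula.Realize, BoundedFormula.realize_subst]
    refine (congrArg (BoundedFormula.Realize φ · default) (funext fun j => ?_)).mpr h0
    rcases j with j | j <;> simp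
  · rw [Formula.realize_imp]
    intro hi
    rw [Formula.Realize, BoundedFormula.realize_subst]
    refine (congrArg (BoundedFormula.Realize φ · default) (funext fun j => ?_)).mpr
      (hs (i 0) ((congrArg (BoundedFormula.Realize φ · default) (funext fun j => ?_)).mpr hi))
    · rcases j with j | j
      · simp
      · simp [Subsingleton.elim j 0]
    · rcases j with j | j
      · simp
      · simp [Subsingleton.elim j 0]

/-- The only form in which the induction scheme enters the later arguments. -/
theorem Delta0Set.induction (hM : M ⊨ ISigma1) {P : M → Prop} (hP : Delta0Set P) (h0 : P 0)
    (hs : ∀ x, P x → P (x + 1)) (x : M) : P x := by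
  obtain ⟨k, φ, p, hφ, h⟩ := hP
  simp only [← h] at *
  exact induction_of_realize hM (.of_isDelta0 hφ) p h0 hs x

end induction

/-! ### The ordered semiring structure of a model of `IΣ₁`. -/

section robinson

variable {M : Type} [Zero M] [One M] [Add M] [Mul M] [LE M] [arith.Structure M] [Interprets M]

theorem robinson_iff : M ⊨ robinson ↔
    (∀ x : M, x + 1 ≠ 0) ∧ (∀ x y : M, x + 1 = y + 1 → x = y) ∧
    (∀ x : M, x ≠ 0 → ∃ y, x = y + 1) ∧ (∀ x : M, x + 0 = x) ∧
    (∀ x y : M, x + (y + 1) = x + y + 1) ∧ (∀ x : M, x * 0 = 0) ∧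
    (∀ x y : M, x * (y + 1) = x * y + x) ∧ ∀ x y : M, x ≤ y ↔ ∃ z, z + x = y := by
  simp [robinson, Theory.model_iff, Sentence.Realize, Formula.Realize, Fin.snoc]

/-- Serves the semiring identities: `s` and `t` are terms for `f` and `g`, and the final two
arguments let `simp` confirm this. -/
theorem induction_eq (hM : M ⊨ ISigma1) (f g : M → M) {k : ℕ}
    (s t : arith.Term ((Fin k ⊕ Fin 1) ⊕ Fin 0)) (p : Fin k → M)
    (h0 : f 0 = g 0) (hs : ∀ x, f x = g x → f (x + 1) = g (x + 1)) (x : M)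
    (hf : ∀ x, s.realize (Sum.elim (Sum.elim p fun _ => x) default) = f x := by intro x; simp)
    (hg : ∀ x, t.realize (Sum.elim (Sum.elim p fun _ => x) default) = g x := by intro x; simp) :
    f x = g x :=
  Delta0Set.induction (P := fun x => f x = g x) hM
    ⟨k, s =' t, p, .eq s t, fun x => by simp [Formula.Realize, hf, hg]⟩ h0 hs x

/-- The consequences of `IΣ₁` that make a model an ordered semiring. -/
theorem commSemiring_laws (hM : M ⊨ ISigma1) :
    (∀ x y z : M, x + y + z = x + (y + z)) ∧ (∀ x y : M, x + y = y + x) ∧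
    (∀ x y z : M, x * y * z = x * (y * z)) ∧ (∀ x y : M, x * y = y * x) ∧
    (∀ x y z : M, x * (y + z) = x * y + x * z) ∧ (∀ x : M, x * 1 = x) ∧
    (∀ x y z : M, x + z = y + z → x = y) ∧ (∀ x y : M, x ≤ y ∨ y ≤ x) := by
  obtain ⟨-, q2, q3, q4, q5, q6, q7, q8⟩ := robinson_iff.1
    (Theory.Model.mono hM Set.subset_union_left)
  have assoc (x y z : M) : x + y + z = x + (y + z) :=
    induction_eq hM (fun z => x + y + z) (fun z => x + (y + z))
      (param 0 + param 1 + indVar) (param 0 + (param 1 + indVar)) ![x, y]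
      (by simp [q4]) (fun z h => by simp [q5, h]) z
  have zero_add (x : M) : 0 + x = x :=
    induction_eq hM (fun x => 0 + x) (fun x => x) (0 + indVar) indVar ![]
      (q4 0) (fun z h => by rw [q5, h]) x
  -- Moves a successor past the left summand, as the induction step for commutativity requires.
  have one_add (x : M) : 1 + x = x + 1 :=
    induction_eq hM (fun x => 1 + x) (fun x => x + 1) (1 + indVar) (indVar + 1) ![]
      (by rw [q4, zero_add]) (fun z h => by rw [q5, h]) x
  have comm (x y : M) : x + y = y + x :=
    induction_eq hM (fun y => x + y) (fun y => y + x) (param 0 + indVar) (indVar + param 0) ![x]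
      (by simp [q4, zero_add]) (fun z h => by rw [q5, h, assoc, ← one_add, ← assoc]) y
  have zero_mul (x : M) : 0 * x = 0 :=
    induction_eq hM (fun x => 0 * x) (fun _ => 0) (0 * indVar) 0 ![]
      (q6 0) (fun z h => by rw [q7, h, q4]) x
  have mul_one (x : M) : x * 1 = x := by
    rw [← zero_add (1 : M), q7, q6, zero_add]
  have succ_mul (x y : M) : (x + 1) * y = x * y + y :=
    induction_eq hM (fun y => (x + 1) * y) (fun y => x * y + y)
      ((param 0 + 1) * indVar) (param 0 * indVar + indVar) ![x] (by simp [q6, q4])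
      (fun z h => by rw [q7, h, q7, assoc, assoc, ← assoc z, comm z, assoc x]) y
  have mul_comm (x y : M) : x * y = y * x :=
    induction_eq hM (fun y => x * y) (fun y => y * x) (param 0 * indVar) (indVar * param 0) ![x]
      (by simp [q6, zero_mul]) (fun z h => by rw [q7, h, succ_mul]) y
  have distrib (x y z : M) : x * (y + z) = x * y + x * z :=
    induction_eq hM (fun z => x * (y + z)) (fun z => x * y + x * z)
      (param 0 * (param 1 + indVar)) (param 0 * param 1 + param 0 * indVar) ![x, y]
      (by simp [q4, q6]) (fun z h => by rw [q5, q7, h, q7, assoc]) z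
  have mul_assoc (x y z : M) : x * y * z = x * (y * z) :=
    induction_eq hM (fun z => x * y * z) (fun z => x * (y * z))
      (param 0 * param 1 * indVar) (param 0 * (param 1 * indVar)) ![x, y]
      (by simp [q6]) (fun z h => by rw [q7, q7, h, distrib]) z
  refine ⟨assoc, comm, mul_assoc, mul_comm, distrib, mul_one, fun x y z => ?_, fun x y => ?_⟩
  · refine Delta0Set.induction (P := fun z => x + z = y + z → x = y) hM
      ⟨2, ((param 0 + indVar) =' (param 1 + indVar)) ⟹ (param 0 =' param 1), ![x, y],
        (IsDelta0.eq _ _).imp (.eq _ _), fun z => by simp [Formula.Realize]⟩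
      (by simp [q4]) (fun z hz h => hz (q2 _ _ ?_)) z
    rwa [q5, q5] at h
  · refine Delta0Set.induction (P := fun x => x ≤ y ∨ y ≤ x) hM
      ⟨1, (indVar.le (param 0)) ⊔ ((param 0).le indVar), ![y],
        (IsDelta0.le _ _).sup (.le _ _), fun z => by simp [Formula.Realize]⟩
      (Or.inl ((q8 _ _).2 ⟨y, q4 y⟩)) (fun x hx => ?_) x
    rcases hx with hx | hx
    · obtain ⟨z, rfl⟩ := (q8 _ _).1 hx
      by_cases hz : z = 0
      · subst hz
        exact Or.inr ((q8 _ _).2 ⟨1, by rw [zero_add, comm]⟩)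
      · obtain ⟨w, rfl⟩ := q3 z hz
        exact Or.inl ((q8 _ _).2 ⟨w, by rw [← one_add x, ← assoc]⟩)
    · obtain ⟨z, rfl⟩ := (q8 _ _).1 hx
      exact Or.inr ((q8 _ _).2 ⟨1 + z, by rw [assoc, one_add]⟩)

end robinson

section instances

variable {M : Type} [arith.Structure M]
/-- A model of `IΣ₁` is a commutative semiring. -/
noncomputable abbrev commSemiringOf (hM : M ⊨ ISigma1) : CommSemiring M :=
  let := zeroOf M
  let := oneOf M
  let := addOf M
  let := mulOf M
  let := arith.leOfStructure M
  have := interprets_of M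
  have q := robinson_iff.1 (Theory.Model.mono hM Set.subset_union_left)
  have h := commSemiring_laws hM
  { zeroOf M, oneOf M, addOf M, mulOf M with
    add_assoc := h.1
    add_comm := h.2.1
    zero_add := fun x => (h.2.1 0 x).trans (q.2.2.2.1 x)
    add_zero := q.2.2.2.1
    mul_assoc := h.2.2.1
    mul_comm := h.2.2.2.1
    left_distrib := h.2.2.2.2.1
    right_distrib := fun x y z => by
      rw [h.2.2.2.1, h.2.2.2.2.1, h.2.2.2.1, h.2.2.2.1 z]
    zero_mul := fun x => (h.2.2.2.1 0 x).trans (q.2.2.2.2.2.1 x)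
    mul_zero := q.2.2.2.2.2.1
    one_mul := fun x => (h.2.2.2.1 1 x).trans (h.2.2.2.2.2.1 x)
    mul_one := h.2.2.2.2.2.1
    nsmul := nsmulRec
    npow := npowRec
    natCast := Nat.unaryCast }

/-- A model of `IΣ₁` is linearly ordered. -/
noncomputable abbrev linearOrderOf (hM : M ⊨ ISigma1) : LinearOrder M :=
  let := zeroOf M
  let := oneOf M
  let := addOf M
  let := mulOf M
  let := arith.leOfStructure M
  have := interprets_of M
  have q := robinson_iff.1 (Theory.Model.mono hM Set.subset_union_left)
  have h := commSemiring_laws hM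
  have hle := q.2.2.2.2.2.2.2
  have zero_add (x : M) : 0 + x = x := (h.2.1 0 x).trans (q.2.2.2.1 x)
  { arith.leOfStructure M with
    le_refl := fun x => (hle x x).2 ⟨0, zero_add x⟩
    le_trans := fun x y z hxy hyz => by
      obtain ⟨u, rfl⟩ := (hle _ _).1 hxy
      obtain ⟨v, rfl⟩ := (hle _ _).1 hyz
      exact (hle _ _).2 ⟨v + u, h.1 _ _ _⟩
    le_antisymm := fun x y hxy hyx => by
      obtain ⟨u, rfl⟩ := (hle _ _).1 hxy
      obtain ⟨v, hv⟩ := (hle _ _).1 hyx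
      have hvu : v + u = 0 := h.2.2.2.2.2.2.1 _ _ x (by rw [h.1, hv, zero_add])
      have hu : u = 0 := by
        by_contra hu
        obtain ⟨w, rfl⟩ := q.2.2.1 u hu
        exact q.1 (v + w) ((q.2.2.2.2.1 v w).symm.trans hvu)
      rw [hu, zero_add]
    le_total := h.2.2.2.2.2.2.2
    toDecidableLE := Classical.decRel _ }

/-- The semiring and the order are built on the raw operations, so the two interpretations agree
definitionally. -/
theorem interprets_semiring (hM : M ⊨ ISigma1) :
    let := commSemiringOf hM
    let := linearOrderOf hM
    Interprets M := interprets_of M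

end instances

section ordered

variable {M : Type} [CommSemiring M] [LinearOrder M] [arith.Structure M] [Interprets M]

/-- The order of a model of `IΣ₁` is compatible with the operations, and discrete. -/
theorem ordered_laws (hM : M ⊨ ISigma1) :
    CanonicallyOrderedAdd M ∧ IsStrictOrderedRing M ∧ ∀ x y : M, x < y ↔ x + 1 ≤ y := by
  obtain ⟨q1, -, q3, -, -, -, -, q8⟩ := robinson_iff.1
    (Theory.Model.mono hM Set.subset_union_left)
  obtain ⟨-, -, -, -, -, -, cancel, -⟩ := commSemiring_laws hM
  have le_iff (x y : M) : x ≤ y ↔ ∃ z, y = x + z :=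
    (q8 x y).trans (exists_congr fun z => by rw [add_comm, eq_comm])
  have hc : CanonicallyOrderedAdd M :=
    { exists_add_of_le := fun {x y} h => (le_iff x y).1 h
      le_add_self := fun x y => (le_iff _ _).2 ⟨y, add_comm _ _⟩
      le_self_add := fun x y => (le_iff _ _).2 ⟨y, rfl⟩ }
  -- A nonzero difference is a successor; this is the discreteness of the order.
  have hlt (x y : M) : x < y ↔ x + 1 ≤ y := by
    constructor
    · intro h
      obtain ⟨z, rfl⟩ := (le_iff _ _).1 h.le
      obtain ⟨w, rfl⟩ := q3 z (by rintro rfl; simp at h)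
      exact (le_iff _ _).2 ⟨w, by ring⟩
    · intro h
      refine lt_of_le_of_ne (le_trans ((le_iff _ _).2 ⟨1, rfl⟩) h) ?_
      rintro rfl
      obtain ⟨z, hz⟩ := (le_iff _ _).1 h
      exact q1 z (cancel _ _ x (by rw [zero_add]; nth_rw 2 [hz]; ring))
  have hadd (x y z : M) : x ≤ y → x + z ≤ y + z := fun h => by
    obtain ⟨w, rfl⟩ := (le_iff _ _).1 h
    exact (le_iff _ _).2 ⟨w, by ring⟩
  refine ⟨hc, ?_, hlt⟩
  have hord : IsOrderedAddMonoid M :=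
    { add_le_add_left := fun x y h z => hadd x y z h }
  have hcancel : IsOrderedCancelAddMonoid M :=
    { add_le_add_left := fun x y h z => hadd x y z h
      le_of_add_le_add_left := fun x y z h => by
        obtain ⟨w, hw⟩ := (le_iff _ _).1 h
        exact (le_iff _ _).2 ⟨w, cancel _ _ x (by rw [add_comm, hw]; ring)⟩ }
  have hmul (a b c : M) (ha : 0 < a) (h : b < c) : a * b < a * c := by
    obtain ⟨z, rfl⟩ := (le_iff _ _).1 ((hlt _ _).1 h)
    refine lt_of_lt_of_le (lt_add_of_pos_right (a * b) ha) ((le_iff _ _).2 ⟨a * z, by ring⟩)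
  exact
    { zero_le_one := (le_iff _ _).2 ⟨1, by rw [zero_add]⟩
      exists_pair_ne := ⟨0, 1, fun h => q1 0 (by rw [zero_add, ← h])⟩
      mul_lt_mul_of_pos_left := fun a ha b c h => hmul a b c ha h
      mul_lt_mul_of_pos_right := fun a ha b c h => by
        rw [mul_comm b, mul_comm c]; exact hmul a b c ha h }

end ordered

@[simp] theorem snoc_fin_zero {M : Type} (xs : Fin 0 → M) (x : M) :
    (Fin.snoc xs x : Fin 1 → M) 0 = x := rfl

/-! ### Divisibility, primes and radicals. -/

section arithmetic

set_option linter.unusedSectionVars false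

variable {M : Type} [CommSemiring M] [LinearOrder M] [CanonicallyOrderedAdd M]
  [IsStrictOrderedRing M]

/-- In place of subtraction, the cofactors of `u` and `u + v` are compared; if that of `u + v` is
not the larger one, then `v = 0`. -/
theorem dvd_of_dvd_add {a u v : M} (h : a ∣ u + v) (hu : a ∣ u) : a ∣ v := by
  obtain ⟨s, rfl⟩ := hu
  obtain ⟨t, ht⟩ := h
  rcases le_total s t with hst | hst
  · obtain ⟨z, rfl⟩ := exists_add_of_le hst
    exact ⟨z, add_left_cancel (ht.trans (mul_add a s z))⟩
  · obtain ⟨z, rfl⟩ := exists_add_of_le hst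
    have h0 : a * z + v = 0 :=
      add_left_cancel (a := a * t) (by rw [← add_assoc, ← mul_add, ht, add_zero])
    rw [(add_eq_zero.1 h0).2]
    exact dvd_zero a

variable [arith.Structure M] [Interprets M]

theorem lt_iff_add_one_le (hM : M ⊨ ISigma1) {x y : M} : x < y ↔ x + 1 ≤ y :=
  (ordered_laws hM).2.2 x y

theorem one_le_of_ne_zero (hM : M ⊨ ISigma1) {x : M} (hx : x ≠ 0) : 1 ≤ x := by
  simpa using (lt_iff_add_one_le hM).1 (pos_iff_ne_zero.2 hx)

theorem exists_eq_add_one (hM : M ⊨ ISigma1) {x : M} (hx : x ≠ 0) : ∃ y, x = y + 1 := by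
  obtain ⟨y, rfl⟩ := exists_add_of_le (one_le_of_ne_zero hM hx)
  exact ⟨y, add_comm _ _⟩

theorem eq_one_of_mul_eq_one (hM : M ⊨ ISigma1) {x y : M} (h : x * y = 1) : x = 1 := by
  have hx : x ≠ 0 := by rintro rfl; simp at h
  have hy : y ≠ 0 := by rintro rfl; simp at h
  refine le_antisymm ?_ (one_le_of_ne_zero hM hx)
  exact h ▸ le_mul_of_one_le_right zero_le (one_le_of_ne_zero hM hy)

theorem le_of_dvd (hM : M ⊨ ISigma1) {x y : M} (h : x ∣ y) (hy : y ≠ 0) : x ≤ y := by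
  obtain ⟨z, rfl⟩ := h
  exact le_mul_of_one_le_right zero_le (one_le_of_ne_zero hM (right_ne_zero_of_mul hy))

/-- The least element of a definable set. The formula defines the set by its bound variable; its
induction variable is void. -/
theorem exists_least (hM : M ⊨ ISigma1) (P : M → Prop) {k : ℕ}
    (φ : arith.BoundedFormula (Fin k ⊕ Fin 1) 1) (p : Fin k → M) (hφ : IsDelta0 φ)
    (h : ∀ x z, φ.Realize (Sum.elim p fun _ => z) (Fin.snoc default x) ↔ P x)
    (hP : ∃ x, P x) : ∃ x, P x ∧ ∀ y < x, ¬ P y := by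
  by_contra! hc
  -- Strong induction: the bounded quantifier keeps the induction formula `Δ₀`.
  have key : ∀ x, ∀ y ≤ x, ¬ P y := by
    refine Delta0Set.induction hM ⟨k, ∀' (((new 0).le (up indVar)) ⟹ ∼φ), p,
      .ball _ hφ.not, fun x => by simp [Formula.Realize, h]⟩ ?_ ?_
    · intro y hy hPy
      obtain ⟨z, hz, -⟩ := hc y hPy
      exact absurd (hz.trans_le hy) (not_lt.2 zero_le)
    · intro x hx y hy hPy
      obtain ⟨z, hz, hPz⟩ := hc y hPy
      have := (lt_iff_add_one_le hM).1 (hz.trans_le hy)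
      exact hx z (le_of_add_le_add_right this) hPz
  obtain ⟨x, hx⟩ := hP
  exact key x x le_rfl hx

/-- The quotient is the predecessor of the least `x` with `a < m * x`; `x = a + 1` shows that such
an `x` exists. -/
theorem exists_eq_mul_add (hM : M ⊨ ISigma1) (a : M) {m : M} (hm : m ≠ 0) :
    ∃ q r, a = m * q + r ∧ r < m := by
  have hm1 := one_le_of_ne_zero hM hm
  obtain ⟨x, hx, hmin⟩ := exists_least hM (fun x => a < m * x) (k := 2)
    ((param 0).lt (param 1 * new 0)) ![a, m]
    (show IsDelta0 (_ ⊓ ∼_) from (IsDelta0.le _ _).inf (IsDelta0.le _ _).not) (fun x z => by simp)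
    ⟨a + 1, ((lt_iff_add_one_le hM).2 le_rfl).trans_le (le_mul_of_one_le_left zero_le hm1)⟩
  have hx0 : x ≠ 0 := by rintro rfl; simp at hx
  obtain ⟨w, rfl⟩ := exists_eq_add_one hM hx0
  obtain ⟨r, hr⟩ := exists_add_of_le (not_lt.1 (hmin w ((lt_iff_add_one_le hM).2 le_rfl)))
  refine ⟨w, r, hr, ?_⟩
  rw [hr, mul_add, mul_one] at hx
  exact lt_of_add_lt_add_left hx

/-- `s ∣ t`, as a `Δ₀`-formula. -/
def bdvd {α : Type} {n : ℕ} (s t : arith.Term (α ⊕ Fin n)) : arith.BoundedFormula α n :=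
  (t =' 0) ⊔ ∃' (((new n).le (up t)) ⊓ (up t =' (up s * new n)))

theorem IsDelta0.bdvd {α : Type} {n : ℕ} (s t : arith.Term (α ⊕ Fin n)) :
    IsDelta0 (WeakExp.bdvd s t) :=
  .sup (.eq _ _) (.bex t (.eq _ _))

/-- A cofactor of a nonzero number is bounded by that number, so divisibility may occur in the
formulas given to `exists_least`. -/
theorem realize_bdvd (hM : M ⊨ ISigma1) {α : Type} {n : ℕ} (s t : arith.Term (α ⊕ Fin n))
    (v : α → M) (xs : Fin n → M) : (bdvd s t).Realize v xs ↔
      s.realize (Sum.elim v xs) ∣ t.realize (Sum.elim v xs) := by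
  simp only [bdvd, BoundedFormula.realize_sup, BoundedFormula.realize_bdEqual, realize_zero,
    BoundedFormula.realize_ex, BoundedFormula.realize_inf, Term.realize_le, realize_new, realize_up,
    realize_mul, Sum.elim_inr, Fin.snoc_last]
  constructor
  · rintro (h | ⟨c, -, h⟩)
    · rw [h]; exact dvd_zero _
    · exact ⟨c, h⟩
  · rintro ⟨c, h⟩
    by_cases h0 : t.realize (Sum.elim v xs) = 0
    · exact Or.inl h0
    · exact Or.inr ⟨c, le_of_dvd hM ⟨_, h.trans (mul_comm _ _)⟩ h0, h⟩

/-- The only common divisor of `a` and `b` is `1`. -/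
def Coprime (a b : M) : Prop := ∀ d, d ∣ a → d ∣ b → d = 1

/-- Euclid's lemma without Bézout coefficients. By division with remainder, the least nonzero `x`
with `a ∣ x * c` divides every `y` with `a ∣ y * c`. In particular it divides `a` and `b`, so it is
`1`. -/
theorem Coprime.dvd_of_dvd_mul_left (hM : M ⊨ ISigma1) {a b c : M} (hab : Coprime a b)
    (h : a ∣ b * c) : a ∣ c := by
  by_cases hb : b = 0
  · rw [hab a dvd_rfl (hb ▸ dvd_zero a)]
    exact one_dvd c
  obtain ⟨x, ⟨hx0, hx⟩, hmin⟩ := exists_least hM (fun x => x ≠ 0 ∧ a ∣ x * c)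
    (∼(new 0 =' 0) ⊓ bdvd (param 0) (new 0 * param 1)) ![a, c]
    ((IsDelta0.eq _ _).not.inf (.bdvd _ _)) (fun x z => by simp [realize_bdvd hM]) ⟨b, hb, h⟩
  have key {y : M} (hy : a ∣ y * c) : x ∣ y := by
    obtain ⟨q, r, rfl, hr⟩ := exists_eq_mul_add hM y hx0
    have hr0 : r = 0 := by
      by_contra hr0
      refine hmin r hr ⟨hr0, dvd_of_dvd_add (u := q * (x * c)) ?_ (hx.mul_left q)⟩
      convert hy using 1
      ring
    rw [hr0, add_zero]
    exact dvd_mul_right x q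
  have := hab x (key (dvd_mul_right a c)) (key h)
  rwa [this, one_mul] at hx

def IsPrime (p : M) : Prop := 1 < p ∧ ∀ d, d ∣ p → d = 1 ∨ d = p

theorem IsPrime.coprime {p a : M} (hp : IsPrime p) (h : ¬ p ∣ a) : Coprime p a := fun d hdp hda =>
  (hp.2 d hdp).resolve_right (by rintro rfl; exact h hda)

theorem IsPrime.dvd_or_dvd (hM : M ⊨ ISigma1) {p a b : M} (hp : IsPrime p) (h : p ∣ a * b) :
    p ∣ a ∨ p ∣ b :=
  or_iff_not_imp_left.2 fun ha => (hp.coprime ha).dvd_of_dvd_mul_left hM h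

theorem IsPrime.dvd_mul_iff (hM : M ⊨ ISigma1) {p a b : M} (hp : IsPrime p) :
    p ∣ a * b ↔ p ∣ a ∨ p ∣ b :=
  ⟨hp.dvd_or_dvd hM, fun h => h.elim (fun h => h.mul_right b) (fun h => h.mul_left a)⟩

/-- For `a ≠ 0`, the least divisor other than `1` is prime. -/
theorem exists_isPrime_dvd (hM : M ⊨ ISigma1) {a : M} (ha : a ≠ 1) : ∃ p, IsPrime p ∧ p ∣ a := by
  have h12 : (1 : M) < 1 + 1 := (lt_iff_add_one_le hM).2 le_rfl
  -- Every number divides `0`, so a prime divisor of `1 + 1` serves when `a = 0`.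
  wlog ha0 : a ≠ 0 generalizing a
  · obtain ⟨p, hp, -⟩ := this h12.ne' (zero_lt_one.trans h12).ne'
    exact ⟨p, hp, not_not.1 ha0 ▸ dvd_zero p⟩
  obtain ⟨p, ⟨hp1, hp⟩, hmin⟩ := exists_least hM (fun x => x ≠ 1 ∧ x ∣ a)
    (∼(new 0 =' 1) ⊓ bdvd (new 0) (param 0)) ![a]
    ((IsDelta0.eq _ _).not.inf (.bdvd _ _)) (fun x z => by simp [realize_bdvd hM]) ⟨a, ha, dvd_rfl⟩
  have hp0 : p ≠ 0 := by rintro rfl; exact ha0 (zero_dvd_iff.1 hp)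
  refine ⟨p, ⟨lt_of_le_of_ne (one_le_of_ne_zero hM hp0) hp1.symm, fun d hd => ?_⟩, hp⟩
  by_contra! hc
  exact hmin d (lt_of_le_of_ne (le_of_dvd hM hd hp0) hc.2) ⟨hc.1, hd.trans hp⟩

/-- `r` is squarefree and has the same prime divisors as `a`. -/
def IsRad (a r : M) : Prop :=
  (∀ m, m * m ∣ r → m = 1) ∧ ∀ p, IsPrime p → (p ∣ a ↔ p ∣ r)

/-- The radical is the squarefree divisor `r` whose cofactor `y` is least. If a prime `p` divided
`a` but not `r`, it would divide `y`, and moving it from `y` to `r` would give a smaller cofactor.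
-/
theorem exists_isRad (hM : M ⊨ ISigma1) {a : M} (ha : a ≠ 0) : ∃ r ≤ a, IsRad a r := by
  obtain ⟨y, ⟨r, hyr, hr⟩, hmin⟩ := exists_least hM
    (fun y => ∃ r, a = y * r ∧ ∀ m, m * m ∣ r → m = 1)
    (∃' (((new 1).le (up (param 0))) ⊓ ((up (param 0) =' (up (new 0) * new 1)) ⊓
      ∀' (((new 2).le (up (new 1))) ⟹ (bdvd (new 2 * new 2) (up (new 1)) ⟹ (new 2 =' 1)))))) ![a]
    (.bex _ ((IsDelta0.eq _ _).inf (.ball _ ((IsDelta0.bdvd _ _).imp (.eq _ _)))))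
    (fun y z => by
      simp only [BoundedFormula.realize_ex, BoundedFormula.realize_inf, Term.realize_le,
        realize_new, realize_up, realize_mul, BoundedFormula.realize_bdEqual, realize_param,
        BoundedFormula.realize_all, BoundedFormula.realize_imp, realize_bdvd hM, realize_one,
        Sum.elim_inr, Fin.snoc_last, Matrix.cons_val_zero]
      refine exists_congr fun r => ⟨fun ⟨_, h, hr⟩ => ⟨h, fun m hm => hr m ?_ hm⟩,
        fun ⟨h, hr⟩ => ⟨?_, h, fun m _ hm => hr m hm⟩⟩
      · exact le_of_dvd hM (dvd_of_mul_left_dvd hm) (by rintro rfl; exact ha (by simpa using h))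
      · exact le_of_dvd hM ⟨y, by rw [h, mul_comm]⟩ ha)
    ⟨a, 1, (mul_one a).symm, fun m ⟨c, hc⟩ =>
      eq_one_of_mul_eq_one hM (y := m * c) (by rw [hc, mul_assoc])⟩
  have hy0 : y ≠ 0 := by rintro rfl; simp [ha] at hyr
  have hra : r ∣ a := ⟨y, by rw [hyr, mul_comm]⟩
  refine ⟨r, le_of_dvd hM hra ha, hr, fun p hp => ⟨fun hpa => ?_, fun h => h.trans hra⟩⟩
  by_contra hpr
  obtain ⟨z, rfl⟩ := (hp.dvd_or_dvd hM (hyr ▸ hpa)).resolve_right hpr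
  have hz0 : z ≠ 0 := right_ne_zero_of_mul hy0
  refine hmin z (lt_mul_of_one_lt_left (pos_iff_ne_zero.2 hz0) hp.1)
    ⟨p * r, by rw [hyr]; ring, fun m hm => ?_⟩
  -- `p * r` is squarefree: if `q * q` divides it for a prime `q`, then `q ≠ p` because `p` does not
  -- divide `r`, so both factors `q` go into `r`.
  by_contra hm1
  obtain ⟨q, hq, hqm⟩ := exists_isPrime_dvd hM hm1
  have hqq : q * q ∣ p * r := (mul_dvd_mul hqm hqm).trans hm
  have hq0 : q ≠ 0 := (zero_lt_one.trans hq.1).ne'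
  have eq_of_dvd (h : q ∣ p) : q = p := (hp.2 q h).resolve_left hq.1.ne'
  have hqp : q ≠ p := by
    rintro rfl
    exact hpr ((mul_dvd_mul_iff_left hq0).1 hqq)
  obtain ⟨s, rfl⟩ := (hq.dvd_or_dvd hM (dvd_of_mul_left_dvd hqq)).resolve_left
    fun h => hqp (eq_of_dvd h)
  have hqs : q ∣ p * s := (mul_dvd_mul_iff_left hq0).1 (by rwa [mul_left_comm] at hqq)
  exact hq.1.ne' (hr q (mul_dvd_mul_left q
    ((hq.dvd_or_dvd hM hqs).resolve_left fun h => hqp (eq_of_dvd h))))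

/-- Three numbers can be divided by a greatest common divisor. -/
theorem exists_eq_mul_coprime (hM : M ⊨ ISigma1) {a : M} (ha : a ≠ 0) (b c : M) :
    ∃ g a' b' c', a = g * a' ∧ b = g * b' ∧ c = g * c' ∧
      ∀ d, d ∣ a' → d ∣ b' → d ∣ c' → d = 1 := by
  -- Minimizing the cofactor `a'` makes the common divisor `g` greatest; a further common factor `d`
  -- would be absorbed into `g`.
  obtain ⟨a', ⟨g, rfl, ⟨b', rfl⟩, ⟨c', rfl⟩⟩, hmin⟩ := exists_least hM
    (fun x => ∃ g, a = g * x ∧ g ∣ b ∧ g ∣ c)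
    (∃' (((new 1).le (up (param 0))) ⊓ ((up (param 0) =' (new 1 * up (new 0))) ⊓
      (bdvd (new 1) (up (param 1)) ⊓ bdvd (new 1) (up (param 2)))))) ![a, b, c]
    (.bex _ ((IsDelta0.eq _ _).inf ((IsDelta0.bdvd _ _).inf (.bdvd _ _))))
    (fun x z => by
      simp only [BoundedFormula.realize_ex, BoundedFormula.realize_inf, Term.realize_le,
        realize_new, realize_up, realize_mul, BoundedFormula.realize_bdEqual, realize_param,
        realize_bdvd hM, Sum.elim_inr, Fin.snoc_last, Matrix.cons_val]
      exact exists_congr fun g => and_iff_right_of_imp fun h => le_of_dvd hM ⟨x, h.1⟩ ha)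
    ⟨a, 1, (one_mul a).symm, one_dvd b, one_dvd c⟩
  refine ⟨g, a', b', c', rfl, rfl, rfl, ?_⟩
  rintro d ⟨x, rfl⟩ ⟨y, rfl⟩ ⟨z, rfl⟩
  have hdx : d * x ≠ 0 := right_ne_zero_of_mul ha
  by_contra hd
  have hd1 : 1 < d := lt_of_le_of_ne (one_le_of_ne_zero hM (left_ne_zero_of_mul hdx)) (Ne.symm hd)
  exact hmin x (lt_mul_of_one_lt_left (pos_iff_ne_zero.2 (right_ne_zero_of_mul hdx)) hd1)
    ⟨g * d, (mul_assoc g d x).symm, ⟨y, (mul_assoc g d y).symm⟩, ⟨z, (mul_assoc g d z).symm⟩⟩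

end arithmetic

/-! ### Coding of sequences of standard length. -/

section sequences

set_option linter.unusedSectionVars false

variable {M : Type} [CommSemiring M] [LinearOrder M] [CanonicallyOrderedAdd M]
  [IsStrictOrderedRing M] [arith.Structure M] [Interprets M]

/-- The Chinese remainder theorem for a standard number of moduli. -/
theorem exists_simultaneous_remainder (hM : M ⊨ ISigma1) (m r : ℕ → M) (k : ℕ)
    (hm : ∀ i, m i ≠ 0)
    (h : ∀ j < k, ∀ i < j, ∃ v w, m i * v = m j * w + 1) :
    ∃ c, ∀ i < k, ∃ q, c = m i * q + r i := by
  induction k with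
  | zero => exact ⟨0, by simp⟩
  | succ k ih =>
    obtain ⟨c, hc⟩ := ih fun j hj => h j (hj.trans k.lt_succ_self)
    -- A common multiple `N` of the earlier moduli that is invertible modulo `m k`, with inverse
    -- `v`.
    have hN : ∀ l ≤ k, ∃ N v w, (∀ i < l, m i ∣ N) ∧ N * v = m k * w + 1 := by
      intro l hl
      induction l with
      | zero => exact ⟨1, 1, 0, by simp, by simp⟩
      | succ l ihl =>
        obtain ⟨N, v, w, hN, hv⟩ := ihl (Nat.le_of_succ_le hl)
        obtain ⟨v', w', hv'⟩ := h k k.lt_succ_self l hl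
        refine ⟨N * m l, v * v', w * (m k * w' + 1) + w', fun i hi => ?_, ?_⟩
        · rcases (Nat.lt_succ_iff_lt_or_eq.1 hi) with hi | rfl
          · exact (hN i hi).mul_right _
          · exact dvd_mul_left _ _
        · calc N * m l * (v * v') = (N * v) * (m l * v') := by ring
            _ = _ := by rw [hv, hv']; ring
    obtain ⟨N, v, w, hN, hv⟩ := hN k le_rfl
    -- `e` stands for `-1` modulo `m k`: adding `N * v * (r k + e * c)` changes the residue `c` to
    -- `r k` and leaves the earlier residues alone.
    obtain ⟨e, he⟩ := exists_eq_add_one hM (hm k)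
    refine ⟨c + N * v * (r k + e * c), fun i hi => ?_⟩
    rcases (Nat.lt_succ_iff_lt_or_eq.1 hi) with hi | rfl
    · obtain ⟨q, hq⟩ := hc i hi
      obtain ⟨z, rfl⟩ := hN i hi
      exact ⟨q + z * v * (r k + e * c), by nth_rw 1 [hq]; ring⟩
    · refine ⟨c + w * (r i + e * c), ?_⟩
      rw [hv]
      calc c + (m i * w + 1) * (r i + e * c) = m i * w * (r i + e * c) + (e + 1) * c + r i := by ring
        _ = _ := by rw [← he]; ring

/-- Every sequence of standard length is coded by the `β`-function. -/
theorem exists_beta_code (hM : M ⊨ ISigma1) (r : ℕ → M) (b : M) (hb : b ≠ 0) (k : ℕ)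
    (hr : ∀ i ≤ k, r i ≤ b) :
    ∃ c d, ∀ i ≤ k, (∃ q, c = (1 + ((i : M) + 1) * d) * q + r i) ∧ r i < 1 + ((i : M) + 1) * d := by
  have hk : (k.factorial : M) ≠ 0 := Nat.cast_ne_zero.2 k.factorial_ne_zero
  -- The factor `k!` makes `d` divisible by every difference of two indices, hence the moduli
  -- coprime; the factor `b` makes each modulus exceed the entries.
  let d : M := k.factorial * b
  have hbd : b ≤ d := le_mul_of_one_le_left zero_le (one_le_of_ne_zero hM hk)
  have hinv : ∀ j < k + 1, ∀ i < j, ∃ v w, (1 + ((i : M) + 1) * d) * v =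
      (1 + ((j : M) + 1) * d) * w + 1 := by
    intro j hj i hij
    obtain ⟨δ, hδ, rfl⟩ : ∃ δ, δ ≠ 0 ∧ j = i + δ := ⟨j - i, by omega, by omega⟩
    obtain ⟨f, hf⟩ := Nat.dvd_factorial (Nat.pos_of_ne_zero hδ) (by omega : δ ≤ k)
    have hd : d = δ * (f * b) := by simp only [d, hf, Nat.cast_mul, mul_assoc]
    have hd0 : d ≠ 0 := mul_ne_zero hk hb
    generalize (f : M) * b = d' at hd
    generalize d = d at hd hd0
    obtain ⟨g, hg⟩ := exists_eq_add_one hM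
      (mul_ne_zero (Nat.cast_ne_zero.2 (i + δ).succ_ne_zero) hd0 : ((i + δ + 1 : ℕ) : M) * d ≠ 0)
    push_cast at hg ⊢
    -- Put `J = i + δ + 1` and `m = 1 + J * d`, so that `g + 1 = J * d ≡ -1` modulo `m`. Multiplying
    -- `1 + (i + 1) * d` by `J` gives `δ` modulo `m`; multiplying further by `J * d'` gives `J * d ≡
    -- -1`, and the last factor `g + 1` turns this into `1`.
    refine ⟨(i + δ + 1) * (i + δ + 1) * d' * (g + 1), (i + 1) * (i + δ + 1) * d' * (g + 1) + g, ?_⟩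
    calc (1 + ((i : M) + 1) * d) * ((i + δ + 1) * (i + δ + 1) * d' * (g + 1))
        = ((i + 1) * (i + δ + 1) * d' * (1 + (i + δ + 1) * d) + (i + δ + 1) * (δ * d')) *
            (g + 1) := by ring
      _ = ((i + 1) * (i + δ + 1) * d' * (1 + (g + 1)) + (g + 1)) * (g + 1) := by rw [← hd, hg]
      _ = _ := by rw [hg]; ring
  obtain ⟨c, hc⟩ := exists_simultaneous_remainder hM (fun i => 1 + ((i : M) + 1) * d) r (k + 1)
    (fun i => (zero_lt_one.trans_le le_self_add).ne') hinv
  refine ⟨c, d, fun i hi => ⟨hc i (Nat.lt_succ_iff.2 hi), ?_⟩⟩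
  rw [lt_iff_add_one_le hM, add_comm]
  gcongr
  exact ((hr i hi).trans hbd).trans (le_mul_of_one_le_left zero_le le_add_self)

/-- By discreteness the standard numbers are an initial segment. Hence, for a standard exponent,
`expGraph` constrains only standardly many entries. -/
theorem exists_nat_of_lt (hM : M ⊨ ISigma1) {x : M} {k : ℕ} (h : x < k) : ∃ j < k, x = j := by
  induction k with
  | zero => simp at h
  | succ k ih =>
    rw [Nat.cast_succ, lt_iff_add_one_le hM, add_le_add_iff_right] at h
    rcases h.lt_or_eq with h | rfl
    · obtain ⟨j, hj, rfl⟩ := ih h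
      exact ⟨j, hj.trans k.lt_succ_self, rfl⟩
    · exact ⟨k, k.lt_succ_self, rfl⟩

theorem realize_beta {α : Type} {n : ℕ} (c d i u : arith.Term (α ⊕ Fin n)) (v : α → M)
    (xs : Fin n → M) : (beta c d i u).Realize v xs ↔
      (∃ q, c.realize (Sum.elim v xs) = (1 + (i.realize (Sum.elim v xs) + 1) *
        d.realize (Sum.elim v xs)) * q + u.realize (Sum.elim v xs)) ∧
      u.realize (Sum.elim v xs) < 1 + (i.realize (Sum.elim v xs) + 1) *
        d.realize (Sum.elim v xs) := by
  simp [beta, isRem]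

/-- For a standard exponent, the definable exponential is the power. -/
theorem realize_expGraph_of_pow (hM : M ⊨ ISigma1) {α : Type} {n : ℕ}
    (x y z : arith.Term (α ⊕ Fin n)) (v : α → M) (xs : Fin n → M) (k : ℕ)
    (hx : x.realize (Sum.elim v xs) ≠ 0) (hy : y.realize (Sum.elim v xs) = k)
    (hz : z.realize (Sum.elim v xs) = x.realize (Sum.elim v xs) ^ k) :
    (expGraph x y z).Realize v xs := by
  set a := x.realize (Sum.elim v xs) with ha
  obtain ⟨c, d, h⟩ := exists_beta_code hM (fun i => a ^ i) (a ^ k) (pow_ne_zero k hx) k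
    fun i hi => pow_le_pow_right₀ (one_le_of_ne_zero hM hx) hi
  simp only [expGraph, BoundedFormula.realize_ex, BoundedFormula.realize_inf,
    BoundedFormula.realize_all, BoundedFormula.realize_imp, Term.realize_lt, realize_beta,
    realize_up, realize_new, realize_add, realize_mul, realize_one, realize_zero, Sum.elim_inr,
    Fin.snoc_last, hy, hz, ← ha]
  refine ⟨c, d, ⟨?_, fun i hi => ?_⟩, h k le_rfl⟩
  · simpa using h 0 k.zero_le
  · obtain ⟨j, hj, rfl⟩ := exists_nat_of_lt hM hi
    exact ⟨a ^ j, h j hj.le, by simpa [pow_succ] using h (j + 1) hj⟩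

end sequences

/-! ### The meaning of the arithmetical formulas in a model. -/

section realize

set_option linter.unusedSectionVars false

variable {M : Type} [CommSemiring M] [LinearOrder M] [arith.Structure M] [Interprets M]
variable {α : Type} {n : ℕ}

@[simp] theorem realize_num (k : ℕ) (v : α → M) : (num k).realize v = k := by
  induction k with
  | zero => simp [num]
  | succ k ih => simp [num, ih]

@[simp] theorem realize_tpow (t : arith.Term α) (k : ℕ) (v : α → M) :
    (tpow t k).realize v = t.realize v ^ k := by
  induction k with
  | zero => simp [tpow]
  | succ k ih => simp [tpow, ih, pow_succ]

@[simp] theorem realize_dvd (s t : arith.Term (α ⊕ Fin n)) (v : α → M) (xs : Fin n → M) :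
    (dvd s t).Realize v xs ↔ s.realize (Sum.elim v xs) ∣ t.realize (Sum.elim v xs) := by
  simp [dvd, Dvd.dvd]

theorem realize_coprime (s t : arith.Term (α ⊕ Fin n)) (v : α → M) (xs : Fin n → M) :
    (coprime s t).Realize v xs ↔
      Coprime (s.realize (Sum.elim v xs)) (t.realize (Sum.elim v xs)) := by
  simp [coprime, Coprime]

theorem realize_coprime₃ (s t u : arith.Term (α ⊕ Fin n)) (v : α → M) (xs : Fin n → M) :
    (coprime₃ s t u).Realize v xs ↔ ∀ d, d ∣ s.realize (Sum.elim v xs) →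
      d ∣ t.realize (Sum.elim v xs) → d ∣ u.realize (Sum.elim v xs) → d = 1 := by
  simp [coprime₃]

theorem realize_prime (p : arith.Term (α ⊕ Fin n)) (v : α → M) (xs : Fin n → M) :
    (prime p).Realize v xs ↔ IsPrime (p.realize (Sum.elim v xs)) := by
  simp [prime, IsPrime]

theorem realize_isRad (a r : arith.Term (α ⊕ Fin n)) (v : α → M) (xs : Fin n → M) :
    (isRad a r).Realize v xs ↔
      IsRad (a.realize (Sum.elim v xs)) (r.realize (Sum.elim v xs)) := by
  simp [isRad, IsRad, realize_prime]

theorem realize_abc {K : ℕ} {ε : ℚ} : M ⊨ abc K ε ↔ ∀ a b c r : M, a ≠ 0 → b ≠ 0 → c ≠ 0 →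
    (∀ d, d ∣ a → d ∣ b → d ∣ c → d = 1) → a + b = c → IsRad (a * b * c) r →
    c ^ ε.den < K ^ ε.den * r ^ (ε.den + ε.num.toNat) := by
  simp [abc, Sentence.Realize, Formula.Realize, realize_coprime₃, realize_isRad, Fin.snoc]

end realize

/-! ### Partial exponentials and the Fermat equation. -/

section exponential

set_option linter.unusedSectionVars false

variable {M : Type} [CommSemiring M] [LinearOrder M] [CanonicallyOrderedAdd M]
  [IsStrictOrderedRing M] [arith.Structure M] [Interprets M]

theorem pow_add_pow_ne_pow (hM : M ⊨ ISigma1) (hF : M ⊨ flt) {a b c : M} (ha : a ≠ 0) (hb : b ≠ 0)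
    (hc : c ≠ 0) {k : ℕ} (hk : 2 < (k : M)) : a ^ k + b ^ k ≠ c ^ k := by
  intro h
  simp only [flt, Sentence.Realize, Formula.Realize, BoundedFormula.realize_all,
    BoundedFormula.realize_imp, BoundedFormula.realize_not] at hF
  refine hF a b c k (a ^ k) (b ^ k) ?_ ?_ ?_ ?_ ?_ ?_ ?_
  · simpa [Fin.snoc] using ha
  · simpa [Fin.snoc] using hb
  · simpa [Fin.snoc] using hc
  · simpa [Fin.snoc] using hk
  · exact realize_expGraph_of_pow hM _ _ _ _ _ k ha rfl rfl
  · exact realize_expGraph_of_pow hM _ _ _ _ _ k hb rfl rfl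
  · exact realize_expGraph_of_pow hM _ _ _ _ _ k hc rfl (by simpa [Fin.snoc] using h)

/-- The properties of the graph `G` of a partial exponential that are used. -/
structure IsExp (G : M → M → M → Prop) : Prop where
  unique {x y u v : M} : G x y u → G x y v → u = v
  -- Here and in `pred`, membership of `y` in the domain `A` of exponents is expressed by `G x' y z`
  -- for some `x'` and `z`.
  total (x : M) {x' y z : M} : G x' y z → ∃ u, G x y u
  pred {x y z : M} : G x y z → y ≠ 0 → ∃ w x' z', G x' w z' ∧ y = w + 1
  one_left {x y z : M} : G x y z → G 1 y 1
  zero_right (x : M) : G x 0 1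
  ne_zero {x y u : M} : x ≠ 0 → G x y u → u ≠ 0
  one_right (x : M) : G x 1 x
  add {x y z u v : M} : G x y u → G x z v → G x (y + z) (u * v)
  mul {x y z u v : M} : G x z u → G y z v → G (x * y) z (u * v)
  coprime {x y a b u v : M} : Coprime x y → G x a u → G y b v → Coprime u v

namespace IsExp

variable {G : M → M → M → Prop}

theorem natCast (hG : IsExp G) (x : M) (k : ℕ) : G x k (x ^ k) := by
  induction k with
  | zero => simpa using hG.zero_right x
  | succ k ih => simpa [pow_succ] using hG.add ih (hG.one_right x)

/-- Taking predecessors `N` times either reaches `0`, so that `y` is standard, or leaves an exponent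
that is still in the domain. -/
theorem eq_natCast_or (hG : IsExp G) {x y z : M} (h : G x y z) (N : ℕ) :
    (∃ k : ℕ, y = k) ∨ ∃ w x' z', G x' w z' ∧ y = N + w := by
  induction N with
  | zero => exact Or.inr ⟨y, x, z, h, by simp⟩
  | succ N ih =>
    obtain hk | ⟨w, x', z', hw, rfl⟩ := ih
    · exact Or.inl hk
    by_cases hw0 : w = 0
    · exact Or.inl ⟨N, by simp [hw0]⟩
    · obtain ⟨w', x'', z'', h', rfl⟩ := hG.pred hw hw0
      exact Or.inr ⟨w', x'', z'', h', by push_cast; ring⟩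

/-- A nonstandard exponent is `N + w` with `w` in the domain, and (e4) splits off `e(x, N) = x ^ N`.
-/
theorem pow_dvd (hG : IsExp G) {x y z : M} (h : G x y z) (hy : ∀ k : ℕ, y ≠ k) (N : ℕ) : x ^ N ∣ z := by
  obtain ⟨k, hk⟩ | ⟨w, x', z', hw, rfl⟩ := hG.eq_natCast_or h N
  · exact absurd hk (hy k)
  · obtain ⟨u, hu⟩ := hG.total x hw
    exact ⟨u, hG.unique h (hG.add (hG.natCast x N) hu)⟩

/-- If `p` does not divide `x`, the two are coprime, and (e8) makes `e(p, 1) = p` coprime to `z`.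
The converse is `pow_dvd` with `N = 1`. -/
theorem isPrime_dvd_iff (hG : IsExp G) {x y z p : M} (h : G x y z) (hy : ∀ k : ℕ, y ≠ k) (hp : IsPrime p) :
    p ∣ z ↔ p ∣ x := by
  refine ⟨fun hz => ?_, fun hx => hx.trans (by simpa using hG.pow_dvd h hy 1)⟩
  by_contra hx
  exact hp.1.ne' (hG.coprime (hp.coprime hx) (hG.one_right p) h p dvd_rfl hz)

/-- Solutions of the Fermat equation can be made coprime. -/
theorem exists_coprime_solution (hG : IsExp G) (hM : M ⊨ ISigma1) {a b c n u v : M}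
    (ha : a ≠ 0) (hb : b ≠ 0) (hc : c ≠ 0) (hu : G a n u) (hv : G b n v) (hw : G c n (u + v)) :
    ∃ a b c u v, a ≠ 0 ∧ b ≠ 0 ∧ c ≠ 0 ∧ G a n u ∧ G b n v ∧ G c n (u + v) ∧
      ∀ d, d ∣ a → d ∣ b → d ∣ c → d = 1 := by
  obtain ⟨g, a, b, c, rfl, rfl, rfl, h⟩ := exists_eq_mul_coprime hM ha b c
  obtain ⟨w, hgw⟩ := hG.total g hu
  obtain ⟨u', hu'⟩ := hG.total a hu
  obtain ⟨v', hv'⟩ := hG.total b hu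
  obtain ⟨t', ht'⟩ := hG.total c hu
  -- By (e5') the factor `w = e(g, n)` splits off from all three terms; being nonzero, it cancels.
  have hw0 : w ≠ 0 := hG.ne_zero (left_ne_zero_of_mul ha) hgw
  have h1 := hG.unique hu (hG.mul hgw hu')
  have h2 := hG.unique hv (hG.mul hgw hv')
  have h3 := hG.unique hw (hG.mul hgw ht')
  have h4 : u' + v' = t' := mul_left_cancel₀ hw0 (by rw [mul_add, ← h1, ← h2, h3])
  exact ⟨a, b, c, u', v', right_ne_zero_of_mul ha, right_ne_zero_of_mul hb,
    right_ne_zero_of_mul hc, hu', hv', h4 ▸ ht', h⟩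

end IsExp

/-- The numerical contradiction between the `ABC` inequality and a Fermat solution with a large
exponent. -/
theorem abc_inequality_false (hM : M ⊨ ISigma1) {x C r : M} {K q s N : ℕ} (hq : q ≠ 0)
    (hqs : q ≤ s) (hC : C ≠ 0) (hr : r ≤ x) (hK : (K : M) ^ 2 ≤ C) (hN : N = 6 * s)
    (hx : x ^ N ≤ C ^ 3) (habc : C ^ q < K ^ q * r ^ s) : False := by
  have hC1 := one_le_of_ne_zero hM hC
  -- Squaring the `ABC` inequality lets `K ^ (2 * q) ≤ C ^ q` absorb the constant.
  have h1 : C ^ q < x ^ (2 * s) := by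
    refine lt_of_mul_lt_mul_left (a := C ^ q) ?_ zero_le
    calc C ^ q * C ^ q = (C ^ q) ^ 2 := by ring
      _ < (K ^ q * r ^ s) ^ 2 := pow_lt_pow_left₀ habc zero_le two_ne_zero
      _ = (K ^ 2) ^ q * r ^ (2 * s) := by ring
      _ ≤ C ^ q * x ^ (2 * s) := mul_le_mul' (pow_le_pow_left₀ zero_le hK q)
          (pow_le_pow_left₀ zero_le hr _)
  -- The `N`-th power brings in `x ^ N ≤ C ^ 3`. The resulting exponents satisfy `q * N ≥ 6 * s` for
  -- `N = 6 * s`, which contradicts the strict inequality.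
  have h2 : (C ^ q) ^ N < C ^ (6 * s) :=
    calc (C ^ q) ^ N < (x ^ (2 * s)) ^ N := pow_lt_pow_left₀ h1 zero_le (by omega)
      _ = (x ^ N) ^ (2 * s) := by ring
      _ ≤ (C ^ 3) ^ (2 * s) := pow_le_pow_left₀ zero_le hx _
      _ = C ^ (6 * s) := by ring
  rw [← pow_mul] at h2
  refine h2.not_ge (pow_le_pow_right₀ hC1 ?_)
  rw [hN]
  exact Nat.le_mul_of_pos_left _ (Nat.pos_of_ne_zero hq)

theorem IsExp.add_ne (hM : M ⊨ ISigma1) (hF : M ⊨ flt) {K : ℕ} {ε : ℚ} (hABC : M ⊨ abc K ε)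
    {G : M → M → M → Prop} (hG : IsExp G) {a b c n u v : M} (ha : a ≠ 0) (hb : b ≠ 0)
    (hc : c ≠ 0) (hn : 2 < n) (hu : G a n u) (hv : G b n v) : ¬ G c n (u + v) := by
  intro hw
  -- A standard exponent falls under the Fermat theorem for the definable exponential; `ABC` is
  -- needed only for nonstandard ones.
  by_cases hst : ∃ k : ℕ, n = k
  · obtain ⟨k, rfl⟩ := hst
    refine pow_add_pow_ne_pow hM hF ha hb hc hn ?_
    rw [hG.unique (hG.natCast a k) hu, hG.unique (hG.natCast b k) hv,
      hG.unique (hG.natCast c k) hw]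
  push Not at hst
  clear hn
  obtain ⟨a, b, c, u, v, ha, hb, hc, hu, hv, hw, h⟩ :=
    hG.exists_coprime_solution hM ha hb hc hu hv hw
  have hu0 : u ≠ 0 := hG.ne_zero ha hu
  have hv0 : v ≠ 0 := hG.ne_zero hb hv
  have hw0 : u + v ≠ 0 := hG.ne_zero hc hw
  -- A prime dividing `a` and `b` divides `u` and `v`, hence `u + v`, hence `c`. So coprimality of
  -- the triple passes to the pair, as (e8) requires.
  have hab : Coprime a b := by
    intro d hda hdb
    by_contra hd
    obtain ⟨p, hp, hpd⟩ := exists_isPrime_dvd hM hd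
    refine hp.1.ne' (h p (hpd.trans hda) (hpd.trans hdb) ((hG.isPrime_dvd_iff hw hst hp).1 ?_))
    exact dvd_add ((hG.isPrime_dvd_iff hu hst hp).2 (hpd.trans hda))
      ((hG.isPrime_dvd_iff hv hst hp).2 (hpd.trans hdb))
  -- For `c = 1`, (e1) would give `u + v = 1` with `u` and `v` both nonzero.
  have hc1 : 1 < c := by
    refine lt_of_le_of_ne (one_le_of_ne_zero hM hc) ?_
    rintro rfl
    have := hG.unique hw (hG.one_left hw)
    exact absurd (add_le_add (one_le_of_ne_zero hM hu0) (one_le_of_ne_zero hM hv0))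
      (by rw [this]; exact ((lt_iff_add_one_le hM).2 le_rfl).not_ge)
  obtain ⟨r, hr, hrad⟩ := exists_isRad hM (mul_ne_zero (mul_ne_zero ha hb) hc)
  -- The radical depends only on the prime divisors, which exponentiation to `n` preserves.
  have hrad' : IsRad (u * v * (u + v)) r := by
    refine ⟨hrad.1, fun p hp => ?_⟩
    rw [← hrad.2 p hp, hp.dvd_mul_iff hM, hp.dvd_mul_iff hM, hp.dvd_mul_iff hM, hp.dvd_mul_iff hM,
      hG.isPrime_dvd_iff hu hst hp, hG.isPrime_dvd_iff hv hst hp, hG.isPrime_dvd_iff hw hst hp]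
  have habc := realize_abc.1 hABC u v (u + v) r hu0 hv0 hw0
    (fun d hdu hdv _ => hG.coprime hab hu hv d hdu hdv) rfl hrad'
  refine abc_inequality_false hM ε.den_nz (Nat.le_add_right _ _) hw0 hr ?_ rfl ?_ habc
  -- Since `c ≥ 2` and every standard power of `c` divides `u + v`, the exponent `K ^ 2` is large
  -- enough.
  · calc (K : M) ^ 2 = ((K ^ 2 : ℕ) : M) := by push_cast; rfl
      _ ≤ ((2 ^ K ^ 2 : ℕ) : M) := Nat.cast_le.2 (Nat.lt_two_pow_self).le
      _ = (1 + 1) ^ K ^ 2 := by push_cast; rw [one_add_one_eq_two]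
      _ ≤ c ^ K ^ 2 := pow_le_pow_left₀ zero_le ((lt_iff_add_one_le hM).1 hc1) _
      _ ≤ u + v := le_of_dvd hM (hG.pow_dvd hw hst _) hw0
  -- Each of `a ^ N`, `b ^ N`, `c ^ N` is at most `u + v`.
  · rw [mul_pow, mul_pow, pow_three']
    exact mul_le_mul' (mul_le_mul'
      ((le_of_dvd hM (hG.pow_dvd hu hst _) hu0).trans le_self_add)
      ((le_of_dvd hM (hG.pow_dvd hv hst _) hv0).trans le_add_self))
      (le_of_dvd hM (hG.pow_dvd hw hst _) hw0)

end exponential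

/-! ### From the axioms on `e` to `IsExp`, and the conclusion. -/

section expRealize

set_option linter.unusedSectionVars false

variable {M : Type} [CommSemiring M] [LinearOrder M] [CanonicallyOrderedAdd M]
  [IsStrictOrderedRing M] [arithExp.Structure M] [arith.Structure M] [Interprets M]
  [incl.IsExpansionOn M] {α : Type} {n : ℕ}

/-- The graph of the partial exponential of a structure. -/
def Graph (M : Type) [arithExp.Structure M] (x y z : M) : Prop :=
  Structure.RelMap eRel ![x, y, z]

@[simp] theorem realize_ar (φ : arith.BoundedFormula α n) (v : α → M) (xs : Fin n → M) :
    (ar φ).Realize v xs ↔ φ.Realize v xs :=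
  incl.realize_onBoundedFormula φ

@[simp] theorem realize_E (s t u : arith.Term (α ⊕ Fin n)) (v : α → M) (xs : Fin n → M) :
    (E s t u).Realize v xs ↔ Graph M (s.realize (Sum.elim v xs)) (t.realize (Sum.elim v xs))
      (u.realize (Sum.elim v xs)) := by
  rw [E, BoundedFormula.realize_rel, Graph]
  refine iff_of_eq (congrArg _ (funext fun i => ?_))
  fin_cases i <;> simp

@[simp] theorem realize_inA (t : arith.Term (α ⊕ Fin n)) (v : α → M) (xs : Fin n → M) :
    (inA t).Realize v xs ↔ ∃ x z, Graph M x (t.realize (Sum.elim v xs)) z := by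
  simp [inA]

theorem relativize_equal (s t : arith.Term (α ⊕ Fin n)) : relativize (s =' t) = ar (s =' t) := rfl

theorem isExp_graph (h : M ⊨ ExpPrime ∪ {e5', e8}) : IsExp (Graph M) := by
  have h0 {φ} (hφ : φ ∈ e0) : M ⊨ φ := Theory.model_iff _ |>.1 h _ (.inl (.inl hφ))
  have hs {φ} (hφ : φ ∈ ({e1, e2, e3, e4} : arithExp.Theory)) : M ⊨ φ :=
    Theory.model_iff _ |>.1 h _ (.inl (.inr hφ))
  have h1 : ∀ x y x' z : M, Graph M x' y z → (x = 1 ∨ y = 0 ↔ Graph M x y 1) := by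
    simpa [e1, Sentence.Realize, Formula.Realize, Fin.snoc] using hs (φ := e1) (by simp)
  have h2 : ∀ x y x' z : M, Graph M x' y z → x ≠ 0 → ¬ Graph M x y 0 := by
    simpa [e2, Sentence.Realize, Formula.Realize, Fin.snoc] using hs (φ := e2) (by simp)
  have h3 : ∀ x : M, Graph M x 1 x := by
    simpa [e3, Sentence.Realize, Formula.Realize, Fin.snoc] using hs (φ := e3) (by simp)
  have h4 : ∀ x y z u v : M, Graph M x y u → Graph M x z v → Graph M x (y + z) (u * v) := by
    simpa [e4, Sentence.Realize, Formula.Realize, Fin.snoc] using hs (φ := e4) (by simp)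
  have h5 : ∀ x y z u v : M, Graph M x z u → Graph M y z v → Graph M (x * y) z (u * v) := by
    simpa [e5', Sentence.Realize, Formula.Realize, Fin.snoc] using
      Theory.model_iff _ |>.1 h e5' (.inr (by simp))
  have h8 : ∀ x y a b u v : M, Coprime x y → Graph M x a u → Graph M y b v → Coprime u v := by
    simpa [e8, Sentence.Realize, Formula.Realize, Fin.snoc, realize_coprime] using
      Theory.model_iff _ |>.1 h e8 (.inr (by simp))
  have hu : ∀ x y u v : M, Graph M x y u → Graph M x y v → u = v := by
    simpa [Sentence.Realize, Formula.Realize, Fin.snoc] using h0 (.inl (.inl rfl))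
  have ht : ∀ x y x' z : M, Graph M x' y z → ∃ u, Graph M x y u := by
    simpa [Sentence.Realize, Formula.Realize, Fin.snoc] using h0 (.inl (.inr (.inl rfl)))
  have hz : ∃ x z, Graph M x 0 z := by
    simpa [Sentence.Realize, Formula.Realize] using h0 (.inl (.inr (.inr (.inl rfl))))
  -- The second axiom of `Pr`, relativized. The existential quantifier is encoded as `¬ ∀ ¬`, and
  -- `relativize` acts on this encoding, whence the negated form.
  have hp : ∀ y x z : M, Graph M x y z → y ≠ 0 →
      ¬ ∀ w x z : M, Graph M x w z → y ≠ w + 1 := by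
    simpa [Sentence.Realize, Formula.Realize, Fin.snoc, relativize, relativize_equal,
      BoundedFormula.Realize, -not_forall] using h0 (.inr ⟨_, .inl (.inr (.inl rfl)), rfl⟩)
  obtain ⟨x₀, z₀, hz⟩ := hz
  exact
    { unique := hu _ _ _ _
      total := fun x _ _ _ => ht x _ _ _
      pred := fun hy hy0 => by
        have := hp _ _ _ hy hy0
        push Not at this
        obtain ⟨w, x, z, hw, h⟩ := this
        exact ⟨w, x, z, hw, h⟩
      one_left := fun hy => (h1 _ _ _ _ hy).1 (.inl rfl)
      zero_right := fun x => (h1 x 0 _ _ hz).1 (.inr rfl)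
      ne_zero := fun hx hxy hu0 => h2 _ _ _ _ hxy hx (hu0 ▸ hxy)
      one_right := h3
      add := h4 _ _ _ _ _
      mul := h5 _ _ _ _ _
      coprime := h8 _ _ _ _ _ _ }

end expRealize

theorem fermat_of_abc (T : arith.Theory) (hT : ∀ φ ∈ ISigma1, T ⊨ᵇ φ) (K : ℕ) (ε : ℚ)
    (hABC : T ⊨ᵇ abc K ε) (hFLT : T ⊨ᵇ flt) :
    incl.onTheory T ∪ ExpPrime ∪ {e5', e8} ⊨ᵇ fltE := by
  refine Theory.models_sentence_iff.2 fun M => ?_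
  -- The arithmetical reduct is a model of `T`, so the consequences of `T` can be read off in it.
  let := incl.reduct M
  rw [Theory.models_sentence_iff] at hABC hFLT
  have hMT : (M : Type) ⊨ T := (incl.onTheory_model T).1
    (Theory.Model.mono M.is_model (Set.subset_union_left.trans Set.subset_union_left))
  have hM : (M : Type) ⊨ ISigma1 := (Theory.model_iff _).2 fun φ hφ =>
    Theory.models_sentence_iff.1 (hT φ hφ) (Theory.ModelType.of T M)
  have hMA : (M : Type) ⊨ abc K ε := hABC (Theory.ModelType.of T M)
  have hMF : (M : Type) ⊨ flt := hFLT (Theory.ModelType.of T M)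
  let := commSemiringOf hM
  let := linearOrderOf hM
  have : Interprets M := interprets_semiring hM
  have := (ordered_laws hM).1
  have := (ordered_laws hM).2.1
  have hG : IsExp (Graph M) := isExp_graph
    (Theory.Model.mono M.is_model (by rw [Set.union_assoc]; exact Set.subset_union_right))
  have key (a b c n u v : M) : a ≠ 0 → b ≠ 0 → c ≠ 0 → 2 < n → Graph M a n u → Graph M b n v →
      ¬ Graph M c n (u + v) := hG.add_ne hM hMF hMA
  simpa [fltE, Sentence.Realize, Formula.Realize, Fin.snoc] using key

end WeakExp

theorem theorem6p1 (T : WeakExp.arith.Theory)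
    (hT : ∀ φ ∈ WeakExp.ISigma1, T ⊨ᵇ φ)
    (K : ℕ) (ε : ℚ) (hε : 0 < ε)
    (hABC : T ⊨ᵇ WeakExp.abc K ε)
    (hFLT : T ⊨ᵇ WeakExp.flt) :
    WeakExp.incl.onTheory T ∪ WeakExp.ExpPrime ∪ {WeakExp.e5', WeakExp.e8} ⊨ᵇ
      WeakExp.fltE := WeakExp.fermat_of_abc T hT K ε hABC hFLT
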